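/- \textbf{Definitions.} A model of $T_{\rm feq}$ is a structure $M$ with unary predicates $P,Q$ and a ternary relation $E$ (written $yE_xz$) such that: (a) the universe of $M$ is the disjoint union of $P$ and $Q$, both infinite; (b) $yE_xz$ implies $x\in P$ and $y,z\in Q$; (c) for each $x\in P$, $E_x$ is an equivalence relation on $Q$ with infinitely many classes; (d) for every $n<\omega$, all pairwise distinct $x_1,\dots,x_n\in P$ and all $y_1,\dots,y_n\in Q$ there is $y\in Q$ with $yE_{x_\ell}y_\ell$ for $\ell=1,\dots,n$. Write ${\rm univ}(\lambda,T_{\rm feq})$ for the least cardinality of a family of models of $T_{\rm feq}$ of cardinality $\lambda$ such that every model of $T_{\rm feq}$ of cardinality $\lambda$ embeds into a member of the family (embeddings preserve and reflect $P,Q,E$). A universal model in $\lambda$ is a model of cardinality $\lambda$ into which every model of cardinality $\lambda$ embeds. For infinite cardinals $\theta,\mu$ let ${\rm pp}_{\Gamma(\theta)}(\mu)$ be the supremum of all true cofinalities ${\rm tcf}(\prod_{i\in I}\lambda_i/D)$ that exist, where $|I|\le\theta$, $D$ is a proper $\theta$-complete filter on $I$, each $\lambda_i<\mu$ is an infinite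 regular cardinal, and for every cardinal $\nu<\mu$ we have $\{i\in I:\lambda_i>\nu\}\in D$. Here ${\rm tcf}(\prod_{i\in I}\lambda_i/D)=\kappa$ means that $\kappa$ is regular and there is a $<_D$-increasing sequence of length $\kappa$ that is cofinal in $(\prod_{i\in I}\lambda_i,<_D)$. \textbf{Claim.} Let $\theta,\mu,\lambda$ be infinite cardinals with $\theta={\rm cf}(\theta)={\rm cf}(\mu)<\mu$ and $\mu^+<\lambda={\rm cf}(\lambda)$. Suppose that there is an indexed family $\langle(a_i,b_i):i<i^*\rangle$ with $a_i\subseteq\lambda$, $|a_i|<\mu$, $b_i\subseteq\lambda$, $|b_i|=\theta$ and $|\{b_i:i<i^*\}|\le\lambda$, such that for every $f:\lambda\to\lambda$ there is $i<i^*$ with $f[b_i]\subseteq a_i$. Suppose also that ${\rm pp}_{\Gamma(\theta)}(\mu)>\lambda+|i^*|$. Then: (1) $T_{\rm feq}$ has no universal model in $\lambda$; (2) moreover, ${\rm univ}(\lambda,T_{\rm feq})\ge{\rm pp}_{\Gamma(\theta)}(\mu)$. -/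

import Mathlib

open Cardinal
open scoped FirstOrder

/-! ### The theory of an indexed family of independent equivalence relations -/

/-- Relation symbols: two unary predicates `P`, `Q` and a ternary relation `E`. -/
inductive FeqRel : ℕ → Type
  | P : FeqRel 1
  | Q : FeqRel 1
  | E : FeqRel 3

/-- The relational language of `T_feq`. -/
def feqLang : FirstOrder.Language where
  Functions := fun _ => Empty
  Relations := FeqRel

section Feq

variable {M : Type*} [feqLang.Structure M]

/-- `M ⊨ P(x)`. -/
def feqP (x : M) : Prop :=
  FirstOrder.Language.Structure.RelMap (L := feqLang) FeqRel.P ![x]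

/-- `M ⊨ Q(y)`. -/
def feqQ (y : M) : Prop :=
  FirstOrder.Language.Structure.RelMap (L := feqLang) FeqRel.Q ![y]

/-- `feqE y x z` is `M ⊨ y E_x z`. -/
def feqE (y x z : M) : Prop :=
  FirstOrder.Language.Structure.RelMap (L := feqLang) FeqRel.E ![y, x, z]

variable (M) in
/-- `M` is a model of `T_feq`. -/
structure IsFeqModel : Prop where
  cover : ∀ a : M, feqP a ∨ feqQ a
  disjoint : ∀ a : M, ¬ (feqP a ∧ feqQ a)
  infinite_P : {x : M | feqP x}.Infinite
  infinite_Q : {y : M | feqQ y}.Infinite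
  sorts : ∀ y x z : M, feqE y x z → feqP x ∧ feqQ y ∧ feqQ z
  refl : ∀ x y : M, feqP x → feqQ y → feqE y x y
  symm : ∀ x y z : M, feqE y x z → feqE z x y
  trans : ∀ x y z w : M, feqE y x z → feqE z x w → feqE y x w
  /-- each `E_x` has infinitely many equivalence classes -/
  infinite_classes : ∀ x : M, feqP x →
    {C : Set M | ∃ y : M, feqQ y ∧ C = {z : M | feqE y x z}}.Infinite
  /-- finitely many classes of distinct relations `E_x` always meet -/
  independent : ∀ (n : ℕ) (x y : Fin n → M), Function.Injective x →
    (∀ l, feqP (x l)) → (∀ l, feqQ (y l)) → ∃ z : M, feqQ z ∧ ∀ l, feqE z (x l) (y l)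

end Feq

universe u

/-- A family `N` of models of `T_feq` of cardinality `lam` such that every model of `T_feq` of
cardinality `lam` embeds into a member of the family. -/
def IsFeqUniversalFamily (lam : Cardinal.{u}) {I : Type u}
    (N : I → CategoryTheory.Bundled.{u} feqLang.Structure) : Prop :=
  (∀ i, IsFeqModel (N i) ∧ #(N i) = lam) ∧
    ∀ M : CategoryTheory.Bundled.{u} feqLang.Structure, IsFeqModel M → #M = lam →
      ∃ i, Nonempty (M ↪[feqLang] N i)

/-- `univ(lam, T_feq)`: the least cardinality of a universal family. -/
noncomputable def feqUniv (lam : Cardinal.{u}) : Cardinal.{u} :=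
  sInf {κ | ∃ (I : Type u) (N : I → CategoryTheory.Bundled.{u} feqLang.Structure),
    #I = κ ∧ IsFeqUniversalFamily lam N}

/-- `N` is a universal model of `T_feq` in the cardinal `lam`. -/
def IsFeqUniversalModel (lam : Cardinal.{u})
    (N : CategoryTheory.Bundled.{u} feqLang.Structure) : Prop :=
  IsFeqModel N ∧ #N = lam ∧
    ∀ M : CategoryTheory.Bundled.{u} feqLang.Structure, IsFeqModel M → #M = lam →
      Nonempty (M ↪[feqLang] N)

/-! ### Pseudo-powers -/

/-- `tcf (∏ l i / D) = κ`: the regular cardinal `κ` is the length of a `<_D`-increasing sequence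
that is cofinal in the product `∏ l i` modulo the filter `D`. -/
def HasTrueCofinality {ι : Type u} (D : Filter ι) (l : ι → Cardinal.{u}) (κ : Cardinal.{u}) :
    Prop :=
  κ.IsRegular ∧ ∃ f : κ.ord.ToType → (i : ι) → (l i).ord.ToType,
    (∀ α β, α < β → ∀ᶠ i in D, f α i < f β i) ∧
    (∀ g : (i : ι) → (l i).ord.ToType, ∃ α, ∀ᶠ i in D, g i < f α i)

/-- The set of true cofinalities over which `pp_{Γ(θ)}(μ)` is the supremum: `D` runs over the
proper `θ`-complete filters (dual to the ideals in `Γ(θ)`) on sets of cardinality at most `θ`,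
and `l` over the families of regular cardinals below `μ` with `D`-limit `μ`. -/
def ppSet (θ μ : Cardinal.{u}) : Set Cardinal.{u} :=
  {κ | ∃ (ι : Type u) (D : Filter ι) (l : ι → Cardinal.{u}),
    #ι ≤ θ ∧ D.NeBot ∧ CardinalInterFilter D θ ∧
    (∀ i, (l i).IsRegular ∧ l i < μ) ∧ (∀ ν < μ, ∀ᶠ i in D, ν < l i) ∧
    HasTrueCofinality D l κ}

/-- `pp_{Γ(θ)}(μ)`. -/
noncomputable def ppGamma (θ μ : Cardinal.{u}) : Cardinal.{u} := sSup (ppSet θ μ)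

section Clubs

open Set Order
open scoped Ordinal

theorem Cardinal.IsRegular.exists_forall_lt {c : Cardinal.{u}} (hc : c.IsRegular)
    (s : Set c.ord.ToType) (hs : #s < c) : ∃ b, ∀ x ∈ s, x < b := by
  refine not_isCofinal_iff.1 fun h => (cof_le h).not_gt ?_
  rwa [Ordinal.cof_toType, hc.cof_ord]

theorem Cardinal.mk_Iio_ordToType_lt {c : Cardinal.{u}} (x : c.ord.ToType) : #(Iio x) < c := by
  simpa using mk_Iio_lt x

theorem Cardinal.IsRegular.mk_Iic_lt {c : Cardinal.{u}} (hc : c.IsRegular) (x : c.ord.ToType) :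
    #(Iic x) < c := by
  have := noMaxOrder hc.aleph0_le
  obtain ⟨y, hy⟩ := exists_gt x
  exact (mk_le_mk_of_subset fun z hz => (lt_of_le_of_lt hz hy : z < y)).trans_lt
    (mk_Iio_ordToType_lt y)

theorem Cardinal.IsRegular.exists_isLUB {c : Cardinal.{u}} (hc : c.IsRegular)
    (s : Set c.ord.ToType) (hs : #s < c) : ∃ b, IsLUB s b := by
  obtain ⟨b, hb⟩ := hc.exists_forall_lt s hs
  obtain ⟨m, hm, hmin⟩ := WellFounded.has_min (wellFounded_lt (α := c.ord.ToType)) (upperBounds s)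
    ⟨b, fun x hx => (hb x hx).le⟩
  exact ⟨m, hm, fun y hy => not_lt.1 (hmin y hy)⟩

/-- The points closed under a function form a club in an uncountable regular cardinal. -/
theorem isClub_closurePoints {c : Cardinal.{u}} (hc : c.IsRegular) (hc' : ℵ₀ < c)
    (φ : c.ord.ToType → c.ord.ToType) : IsClub {η | ∀ ξ < η, φ ξ < η} := by
  refine ⟨fun t ht _ _ x hx ξ hξ => ?_, fun a => ?_⟩
  · obtain ⟨y, hy, hy'⟩ := (lt_isLUB_iff hx).1 hξ
    exact (ht hy ξ hy').trans_le (hx.1 hy)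
  · choose ψ hψ using fun x => hc.exists_forall_lt (insert x (φ '' Iic x)) <| by
      refine (mk_insert_le).trans_lt (add_lt_of_lt hc.aleph0_le ?_ (one_lt_aleph0.trans_le hc.1))
      exact mk_image_le.trans_lt (hc.mk_Iic_lt x)
    let g : ℕ → c.ord.ToType := Nat.rec a fun _ x => ψ x
    obtain ⟨b, hb⟩ := hc.exists_isLUB (range g) (by
      refine lt_of_le_of_lt ?_ hc'
      simpa using mk_range_le_lift (f := g))
    refine ⟨b, fun ξ hξ => ?_, hb.1 ⟨0, rfl⟩⟩
    obtain ⟨_, ⟨n, rfl⟩, hn⟩ := (lt_isLUB_iff hb).1 hξ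
    exact (hψ (g n) (φ ξ) (mem_insert_of_mem _ ⟨ξ, hn.le, rfl⟩)).trans_le (hb.1 ⟨n + 1, rfl⟩)

/-- The points closed under a binary function contain a club. -/
theorem exists_forall_closed_lt {c : Cardinal.{u}} (hc : c.IsRegular)
    (G : c.ord.ToType → c.ord.ToType → c.ord.ToType) :
    ∃ φ : c.ord.ToType → c.ord.ToType, ∀ η, (∀ ξ < η, φ ξ < η) → ∀ x < η, ∀ y < η, G x y < η := by
  choose φ hφ using fun z => hc.exists_forall_lt (image2 G (Iic z) (Iic z)) <| by
    refine (mk_image2_le).trans_lt (mul_lt_of_lt hc.1 (hc.mk_Iic_lt z) (hc.mk_Iic_lt z))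
  refine ⟨φ, fun η hη x hx y hy => ?_⟩
  exact (hφ (max x y) _ ⟨x, mem_Iic.2 (le_max_left _ _), y, mem_Iic.2 (le_max_right _ _), rfl⟩).trans
    (hη _ (max_lt hx hy))

/-- Two normal sequences of uncountable regular length with the same supremum agree on arbitrarily
large indices. -/
theorem isCofinal_eqOn_of_isNormal {c : Cardinal.{u}} (hc : c.IsRegular) (hc' : ℵ₀ < c)
    {α : Type u} [LinearOrder α] {d e : c.ord.ToType → α} (hd : IsNormal d) (he : IsNormal e)
    {δ : α} (hdδ : IsLUB (range d) δ) (heδ : IsLUB (range e) δ) : IsCofinal {η | d η = e η} := by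
  have := noMaxOrder hc.aleph0_le
  have key : ∀ {d e : c.ord.ToType → α}, IsNormal d → IsLUB (range d) δ → IsLUB (range e) δ →
      ∀ x, ∃ y, d x < e y := by
    intro d e hd hdδ heδ x
    obtain ⟨x', hx'⟩ := exists_gt x
    obtain ⟨_, ⟨y, rfl⟩, hy⟩ := (lt_isLUB_iff heδ).1 ((hd.strictMono hx').trans_le (hdδ.1 ⟨x', rfl⟩))
    exact ⟨y, hy⟩
  choose p hp using key hd hdδ heδ
  choose q hq using key he heδ hdδ
  choose r hr using fun x : c.ord.ToType => exists_gt x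
  intro a
  obtain ⟨η, hη, haη⟩ :=
    (isClub_closurePoints hc hc' fun x => max (max (p x) (q x)) (r x)).isCofinal (r a)
  have hlim : IsSuccLimit η := by
    refine ⟨fun h => ?_, fun x hx => ?_⟩
    · exact ((hr a).trans_le haη).not_ge (h ((hr a).trans_le haη).le)
    · exact hx.2 (hr x) ((le_max_right _ _).trans_lt (hη x hx.1))
  refine ⟨η, le_antisymm ?_ ?_, (hr a).le.trans haη⟩
  · exact (hd.le_iff_forall_le hlim).2 fun x hx => (hp x).le.trans <| he.monotone
      (((le_max_left _ _).trans (le_max_left _ _)).trans (hη x hx).le)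
  · exact (he.le_iff_forall_le hlim).2 fun x hx => (hq x).le.trans <| hd.monotone
      (((le_max_right _ _).trans (le_max_left _ _)).trans (hη x hx).le)

theorem Cardinal.exists_strictMono_ordToType {α : Type u} [LinearOrder α] [WellFoundedLT α]
    {μ : Cardinal.{u}} (h : μ ≤ #α) : ∃ g : μ.ord.ToType → α, StrictMono g := by
  have : typeLT μ.ord.ToType ≤ typeLT α := by
    rw [Ordinal.type_toType, ord_le]
    simpa using h
  obtain ⟨f⟩ := Ordinal.type_le_iff'.1 this
  exact ⟨f, fun x y hxy => f.map_rel_iff.2 hxy⟩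

/-- A family of small sets such that every club contains `μ` many points of one of them. -/
theorem exists_small_sets_meeting_clubs {μ lam : Cardinal.{u}} (hμ : ℵ₀ ≤ μ) (hlam : lam.IsRegular)
    (hμlam : succ μ < lam) :
    ∃ C : lam.ord.ToType → Set lam.ord.ToType, (∀ p, #(C p) ≤ μ) ∧
      ∀ E, IsClub E → ∃ p, ∃ g : μ.ord.ToType → lam.ord.ToType,
        StrictMono g ∧ ∀ ζ, g ζ ∈ C p ∧ g ζ ∈ E := by
  classical
  have hκ : (succ μ).IsRegular := isRegular_succ hμ
  have hκ' : ℵ₀ < succ μ := lt_succ_of_le hμ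
  have : IsRegularCardinalOrder lam.ord.ToType := ⟨by simp [hlam.cof_ord]⟩
  let D : lam.ord.ToType → (succ μ).ord.ToType → lam.ord.ToType := fun δ =>
    if h : ∃ d : (succ μ).ord.ToType → lam.ord.ToType, IsNormal d ∧ IsLUB (range d) δ
    then h.choose else fun _ => δ
  have hcard : #(lam.ord.ToType × (succ μ).ord.ToType) = #(lam.ord.ToType) := by
    simp only [mk_prod, lift_id, mk_ord_toType]
    exact mul_eq_left hlam.1 hμlam.le (succ_ne_zero μ)
  obtain ⟨e⟩ := Cardinal.eq.1 hcard
  refine ⟨fun p => D (e.symm p).1 '' Iio (e.symm p).2, fun p => ?_, fun E hE => ?_⟩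
  · exact mk_image_le.trans (lt_succ_iff.1 (mk_Iio_ordToType_lt _))
  · obtain ⟨i⟩ : Nonempty ((succ μ).ord.ToType ≤i lam.ord.ToType) := by
      refine Ordinal.type_le_iff.1 ?_
      simpa using hμlam.le
    have hen : IsNormal ((Subtype.val ∘ enum E hE.isCofinal) ∘ i) :=
      hE.isNormal_enum.comp i.isNormal
    set en := (Subtype.val ∘ enum E hE.isCofinal) ∘ i
    have henE : ∀ x, en x ∈ E := fun x => Subtype.property _
    obtain ⟨δ, hδ⟩ := hlam.exists_isLUB (range en) (mk_range_le.trans_lt (by simpa using hμlam))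
    have hD : IsNormal (D δ) ∧ IsLUB (range (D δ)) δ := by
      have h : ∃ d : (succ μ).ord.ToType → lam.ord.ToType, IsNormal d ∧ IsLUB (range d) δ :=
        ⟨en, hen, hδ⟩
      simp only [D, dif_pos h]
      exact h.choose_spec
    have hcof := isCofinal_eqOn_of_isNormal hκ hκ' hD.1 hen hD.2 hδ
    obtain ⟨g, hg⟩ := exists_strictMono_ordToType (μ := μ) (α := {η | D δ η = en η}) <| by
      have := cof_le hcof
      rw [Ordinal.cof_toType, hκ.cof_ord] at this
      exact (le_succ μ).trans this
    obtain ⟨k, hk⟩ := hκ.exists_forall_lt (range fun ζ => (g ζ).1) <|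
      mk_range_le.trans_lt (by simp)
    refine ⟨e (δ, k), fun ζ => D δ (g ζ), fun x y hxy => hD.1.strictMono (hg hxy), fun ζ => ⟨?_, ?_⟩⟩
    · simp only [e.symm_apply_apply]
      exact ⟨g ζ, hk _ ⟨ζ, rfl⟩, rfl⟩
    · have h : D δ (g ζ) = en (g ζ) := (g ζ).2
      simpa only [h] using henE _

attribute [local instance] WellFoundedLT.toOrderBot WellFoundedLT.conditionallyCompleteLinearOrderBot in
theorem exists_club_guessing_sequences {μ lam : Cardinal.{u}} (hμ : ℵ₀ ≤ μ) (hlam : lam.IsRegular)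
    (hμlam : succ μ < lam) :
    ∃ c : lam.ord.ToType → μ.ord.ToType → lam.ord.ToType, (∀ s, StrictMono (c s)) ∧
      ∀ E : Set lam.ord.ToType, IsClub E → (∀ x, IsBot x → x ∈ E) → ∃ s, ∀ ζ, c s ζ ∈ E := by
  classical
  have : Nonempty lam.ord.ToType := by simpa using hlam.ne_zero
  have hκ : (succ μ).IsRegular := isRegular_succ hμ
  have hcof : cof lam.ord.ToType = lam := by rw [Ordinal.cof_toType, hlam.cof_ord]
  have hcof' : cof lam.ord.ToType ≠ ℵ₀ := by
    rw [hcof]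
    exact ((lt_succ_of_le hμ).trans hμlam).ne'
  have := noMaxOrder hκ.aleph0_le
  obtain ⟨C, hC, hCE⟩ := exists_small_sets_meeting_clubs hμ hlam hμlam
  let gl : Set lam.ord.ToType → lam.ord.ToType → lam.ord.ToType := fun E α => sSup (E ∩ Iic α)
  have hbdd : ∀ (E : Set lam.ord.ToType) α, BddAbove (E ∩ Iic α) :=
    fun E α => ⟨α, fun x hx => hx.2⟩
  have gl_mem : ∀ E, IsClub E → ⊥ ∈ E → ∀ α, gl E α ∈ E := fun E hE hb α =>
    hE.csSup_mem inter_subset_left ⟨⊥, hb, mem_Iic.2 bot_le⟩ (hbdd E α)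
  have gl_self : ∀ E, ∀ α ∈ E, gl E α = α := fun E α hα =>
    IsGreatest.csSup_eq ⟨⟨hα, mem_Iic.2 le_rfl⟩, fun x hx => hx.2⟩
  have gl_anti : ∀ E E' : Set lam.ord.ToType, E ⊆ E' → ∀ α, gl E α ≤ gl E' α := fun E E' h α =>
    csSup_le_csSup' (hbdd E' α) (inter_subset_inter_left _ h)
  let Q : Set lam.ord.ToType → Set lam.ord.ToType → Prop := fun E E' => ∃ p,
    ∃ g : μ.ord.ToType → lam.ord.ToType, StrictMono g ∧ (∀ ζ, g ζ ∈ gl E '' C p) ∧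
      gl E '' C p ⊆ E'
  have claim : ∃ E, ∀ E', IsClub E' → ⊥ ∈ E' → Q E E' := by
    by_contra! hcon
    choose nxt hnxt hbot hQ using hcon
    let X : (succ μ).ord.ToType → Set lam.ord.ToType :=
      wellFounded_lt.fix fun ζ ih => ⋂ ξ : Iio ζ, nxt (ih ξ.1 ξ.2)
    have hX : ∀ ζ, X ζ = ⋂ ξ : Iio ζ, nxt (X ξ) := fun ζ => wellFounded_lt.fix_eq _ ζ
    have X_sub : ∀ {ξ ζ}, ξ < ζ → X ζ ⊆ nxt (X ξ) := fun {ξ ζ} h => by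
      rw [hX ζ]
      exact iInter_subset (fun ξ : Iio ζ => nxt (X ξ)) ⟨ξ, h⟩
    have X_anti : ∀ {ξ ζ}, ξ ≤ ζ → X ζ ⊆ X ξ := fun {ξ ζ} h => by
      rw [hX ζ, hX ξ]
      exact subset_iInter fun x => iInter_subset (fun ξ : Iio ζ => nxt (X ξ)) ⟨x.1, x.2.trans_le h⟩
    have X_bot : ∀ ζ, ⊥ ∈ X ζ := fun ζ => by
      rw [hX ζ]
      exact mem_iInter.2 fun ξ => hbot _
    have X_club : ∀ ζ, IsClub (X ζ) := fun ζ => by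
      rw [hX ζ]
      refine IsClub.iInter hcof' ?_ fun ξ => hnxt _
      simpa [hcof, hlam.cof_ord] using (mk_Iio_ordToType_lt ζ).trans hμlam
    obtain ⟨p, g, hg, hgE⟩ := hCE (⋂ ζ, X ζ) <| by
      refine IsClub.iInter hcof' ?_ X_club
      simpa [hcof, hlam.cof_ord] using hμlam
    have stab : ∀ α, ∃ ξ, ∀ ζ, ξ ≤ ζ → gl (X ζ) α = gl (X ξ) α := fun α => by
      have : Nonempty (succ μ).ord.ToType := by simp
      obtain ⟨_, ⟨ξ, rfl⟩, hξ⟩ := WellFounded.has_min wellFounded_lt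
        (range fun ξ => gl (X ξ) α) (range_nonempty _)
      exact ⟨ξ, fun ζ hζ => (gl_anti _ _ (X_anti hζ) α).antisymm (not_lt.1 (hξ _ ⟨ζ, rfl⟩))⟩
    choose ρ hρ using stab
    obtain ⟨ζ, hζ⟩ := hκ.exists_forall_lt (ρ '' C p) (mk_image_le.trans_lt (lt_succ_of_le (hC p)))
    obtain ⟨η, hη⟩ := exists_gt ζ
    refine hQ (X ζ) ⟨p, g, hg, fun z => ⟨g z, (hgE z).1, gl_self _ _ (mem_iInter.1 (hgE z).2 ζ)⟩, ?_⟩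
    rintro _ ⟨α, hα, rfl⟩
    have hα' := (hζ _ ⟨α, hα, rfl⟩).le
    rw [hρ α ζ hα', ← hρ α η (hα'.trans hη.le)]
    exact X_sub hη (gl_mem _ (X_club η) (X_bot η) α)
  obtain ⟨E, hE⟩ := claim
  obtain ⟨-, g₀, hg₀, -⟩ := hE univ .univ (mem_univ _)
  let c : lam.ord.ToType → μ.ord.ToType → lam.ord.ToType := fun p =>
    if h : ∃ g : μ.ord.ToType → lam.ord.ToType, StrictMono g ∧ ∀ ζ, g ζ ∈ gl E '' C p
    then h.choose else g₀
  refine ⟨c, fun s => ?_, fun E' hE' hb => ?_⟩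
  · by_cases h : ∃ g : μ.ord.ToType → lam.ord.ToType, StrictMono g ∧ ∀ ζ, g ζ ∈ gl E '' C s
    · simp only [c, dif_pos h]
      exact h.choose_spec.1
    · simpa only [c, dif_neg h] using hg₀
  · obtain ⟨p, g, hg, hgC, hsub⟩ := hE E' hE' (hb _ isBot_bot)
    have h : ∃ g : μ.ord.ToType → lam.ord.ToType, StrictMono g ∧ ∀ ζ, g ζ ∈ gl E '' C p :=
      ⟨g, hg, hgC⟩
    refine ⟨p, fun ζ => ?_⟩
    simp only [c, dif_pos h]
    exact hsub (h.choose_spec.2 ζ)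

end Clubs

section Model

variable {L : Type u}

/-- The universe of the model of `T_feq` built from the functions `t τ`: the sort `P` is `L`, the
sort `Q` consists of the finite modifications of the functions `t τ`. -/
inductive FeqCarrier (t : L → L → L) : Type u
  | point (x : L)
  | fn (τ : L) (p : L →₀ WithZero L)

namespace FeqCarrier

variable {t : L → L → L}

/-- The value at `x` of the modification of `t τ` by `p`. -/
def value (t : L → L → L) (τ : L) (p : L →₀ WithZero L) (x : L) : L :=
  Option.getD (p x) (t τ x)

/-- Two functions are `E_x`-equivalent when they agree at `x`. -/
def Agree : FeqCarrier t → FeqCarrier t → FeqCarrier t → Prop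
  | fn τ p, point x, fn σ q => value t τ p x = value t σ q x
  | _, _, _ => False

/-- The sort of points. -/
def IsPoint : FeqCarrier t → Prop
  | point _ => True
  | fn _ _ => False

instance : feqLang.Structure (FeqCarrier t) where
  funMap := fun f => nomatch f
  RelMap := fun r v => match r, v with
    | FeqRel.P, v => IsPoint (v 0)
    | FeqRel.Q, v => ¬ IsPoint (v 0)
    | FeqRel.E, v => Agree (v 0) (v 1) (v 2)

theorem feqP_iff (m : FeqCarrier t) : feqP m ↔ IsPoint m := Iff.rfl

theorem feqQ_iff (m : FeqCarrier t) : feqQ m ↔ ¬ IsPoint m := Iff.rfl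

theorem feqE_iff (y x z : FeqCarrier t) : feqE y x z ↔ Agree y x z := Iff.rfl

theorem exists_value_eq (τ : L) (s : Finset L) (v : L → L) :
    ∃ p : L →₀ WithZero L, (∀ x ∈ s, value t τ p x = v x) ∧ ∀ x ∉ s, value t τ p x = t τ x := by
  classical
  let p : L →₀ WithZero L := Finsupp.onFinset s
    (fun x => if x ∈ s then ((v x : L) : WithZero L) else 0) fun x hx => by
      by_contra h
      simp [h] at hx
  refine ⟨p, fun x hx => ?_, fun x hx => ?_⟩
  · have h : p x = ((v x : L) : WithZero L) := by simp [p, hx]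
    simp only [value, h]
    rfl
  · have h : p x = 0 := by simp [p, hx]
    simp only [value, h]
    rfl

theorem isFeqModel [Infinite L] : IsFeqModel (FeqCarrier t) where
  cover m := em _
  disjoint m h := h.2 h.1
  infinite_P := Set.infinite_of_injective_forall_mem (f := fun x : L => point x)
    (fun x y h => by cases h; rfl) fun x => trivial
  infinite_Q := Set.infinite_of_injective_forall_mem (f := fun x : L => fn x 0)
    (fun x y h => by cases h; rfl) fun x => id
  sorts y x z h := by
    rw [feqE_iff] at h
    cases y <;> cases x <;> cases z <;> simp_all [Agree, feqP_iff, feqQ_iff, IsPoint]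
  refl x y hx hy := by
    rw [feqE_iff]
    cases y <;> cases x <;> simp_all [Agree, feqP_iff, feqQ_iff, IsPoint]
  symm y x z h := by
    rw [feqE_iff] at *
    cases y <;> cases x <;> cases z <;> simp_all [Agree]
  trans y x z w h h' := by
    rw [feqE_iff] at *
    cases y <;> cases x <;> cases z <;> cases w <;> simp_all [Agree]
  infinite_classes x hx := by
    rcases x with x | ⟨σ, q⟩
    · obtain ⟨τ⟩ := (inferInstance : Nonempty L)
      choose p hp using fun v : L => exists_value_eq (t := t) τ {x} fun _ => v
      have hp' : ∀ v, value t τ (p v) x = v := fun v => (hp v).1 x (Finset.mem_singleton_self x)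
      refine Set.infinite_of_injective_forall_mem
        (f := fun v : L => {z : FeqCarrier t | feqE (fn τ (p v)) (point x) z}) (fun v w h => ?_)
        fun v => ⟨fn τ (p v), id, rfl⟩
      have h' : value t τ (p v) x = value t τ (p w) x :=
        (Set.ext_iff.1 h (fn τ (p w))).2 (rfl : value t τ (p w) x = _)
      rwa [hp', hp'] at h'
    · exact hx.elim
  independent n x y hx hP hQ := by
    classical
    have hx' : ∀ l, ∃ a, x l = point a := fun l => by
      have := hP l
      rcases h : x l with a | ⟨σ, q⟩
      · exact ⟨a, rfl⟩
      · rw [h] at this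
        exact this.elim
    have hy' : ∀ l, ∃ σ q, y l = fn σ q := fun l => by
      have := hQ l
      rcases h : y l with a | ⟨σ, q⟩
      · rw [h] at this
        exact (this trivial).elim
      · exact ⟨σ, q, rfl⟩
    choose a ha using hx'
    choose σ q hq using hy'
    have ha' : Function.Injective a := fun i j h => hx (by rw [ha, ha, h])
    obtain ⟨τ⟩ := (inferInstance : Nonempty L)
    obtain ⟨p, hp, -⟩ := exists_value_eq (t := t) τ (Finset.univ.image a) fun z =>
      if h : ∃ l, a l = z then value t (σ h.choose) (q h.choose) z else z
    refine ⟨fn τ p, id, fun l => ?_⟩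
    rw [feqE_iff, ha, hq]
    change value t τ p (a l) = _
    rw [hp (a l) (Finset.mem_image_of_mem _ (Finset.mem_univ l))]
    have h : ∃ l', a l' = a l := ⟨l, rfl⟩
    rw [dif_pos h, ha' h.choose_spec]

/-- The universe as a disjoint sum. -/
def equivSum (t : L → L → L) : FeqCarrier t ≃ L ⊕ (L × (L →₀ WithZero L)) where
  toFun
    | point x => .inl x
    | fn τ p => .inr (τ, p)
  invFun
    | .inl x => point x
    | .inr q => fn q.1 q.2
  left_inv m := by cases m <;> rfl
  right_inv m := by rcases m with m | m <;> rfl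

theorem mk_eq [Infinite L] : #(FeqCarrier t) = #L := by
  have h : #(WithZero L) = #L := by
    change #(Option L) = #L
    simp
  simp [mk_congr (equivSum t), h]

end FeqCarrier

end Model

section Main

open FeqCarrier

theorem feqE_map_iff {M N : Type*} [feqLang.Structure M] [feqLang.Structure N]
    (F : M ↪[feqLang] N) (y x z : M) : feqE (F y) (F x) (F z) ↔ feqE y x z := by
  have h : F ∘ ![y, x, z] = ![F y, F x, F z] := by
    ext i
    fin_cases i <;> rfl
  have h' := F.map_rel (FeqRel.E : feqLang.Relations 3) ![y, x, z]
  rw [h] at h'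
  exact h'

theorem exists_feqModel_not_embedding {θ μ lam κ : Cardinal.{u}}
    (hθ : θ.IsRegular) (hθμ : θ < μ) (hlam : lam.IsRegular) (hμlam : Order.succ μ < lam)
    {ι : Type u} (hκ : κ ∈ ppSet θ μ) (hκι : lam + #ι < κ)
    (a b : ι → Set lam.ord.ToType) (ha : ∀ i, #(a i) < μ) (hb : ∀ i, #(b i) = θ)
    (hrange : #(Set.range b) ≤ lam)
    (hguess : ∀ f : lam.ord.ToType → lam.ord.ToType, ∃ i, f '' b i ⊆ a i)
    {I : Type u} (hI : #I < κ) (N : I → CategoryTheory.Bundled.{u} feqLang.Structure)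
    (hN : ∀ j, IsFeqModel (N j) ∧ #(N j) = lam) :
    ∃ M : CategoryTheory.Bundled.{u} feqLang.Structure, IsFeqModel M ∧ #M = lam ∧
      ∀ j, IsEmpty (M ↪[feqLang] N j) := by
  classical
  obtain ⟨J, D, l, hJ, hD, -, hl, hlim, hκreg, f, hfinc, hfcof⟩ := hκ
  have hμ : ℵ₀ ≤ μ := hθ.1.trans hθμ.le
  have hμlam' : μ < lam := (Order.lt_succ μ).trans hμlam
  obtain ⟨c, hc, hcE⟩ := exists_club_guessing_sequences hμ hlam hμlam
  have hLne : Nonempty lam.ord.ToType := by simpa using hlam.ne_zero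
  have hLinf : Infinite lam.ord.ToType := infinite_iff.2 (by simpa using hlam.1)
  let e : ∀ j, N j ≃ lam.ord.ToType := fun j =>
    (Cardinal.eq.1 ((hN j).2.trans (mk_ord_toType lam).symm)).some
  choose emb hemb using fun ε => exists_strictMono_ordToType (μ := l ε) (α := μ.ord.ToType)
    (by simpa using (hl ε).2.le)
  -- `R j n s p ζ`: the class of `n` under `E_p` appears in the filtration of `N j` right after `ζ`
  let R : ∀ j, N j → lam.ord.ToType → N j → μ.ord.ToType → Prop := fun j n s p ζ =>
    ∀ ζ', (∃ m, e j m < c s ζ' ∧ feqE n p m) ↔ ζ < ζ'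
  have R_unique : ∀ {j n s p ζ ζ'}, R j n s p ζ → R j n s p ζ' → ζ = ζ' := fun h h' =>
    le_antisymm (not_lt.1 fun hlt => lt_irrefl _ ((h _).1 ((h' _).2 hlt)))
      (not_lt.1 fun hlt => lt_irrefl _ ((h' _).1 ((h _).2 hlt)))
  let B : (w : I × lam.ord.ToType × lam.ord.ToType × ι) → ∀ ε, Set (l ε).ord.ToType :=
    fun w ε => {z | ∃ p ∈ a w.2.2.2,
      R w.1 ((e w.1).symm w.2.1) w.2.2.1 ((e w.1).symm p) (emb ε z)}
  have hB : ∀ w ε, #(B w ε) ≤ #(a w.2.2.2) := fun w ε => by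
    choose p hp hpR using fun z : B w ε => z.2
    refine mk_le_of_injective (f := fun z => (⟨p z, hp z⟩ : a w.2.2.2)) fun z z' h => ?_
    have h' : p z = p z' := congrArg Subtype.val h
    have := hpR z'
    rw [← h'] at this
    exact Subtype.ext ((hemb ε).injective (R_unique (hpR z) this))
  have hlne : ∀ ε, Nonempty (l ε).ord.ToType := fun ε => by simpa using (hl ε).1.ne_zero
  have hg : ∀ w ε, ∃ g, #(a w.2.2.2) < l ε → ∀ z ∈ B w ε, z < g := fun w ε => by
    by_cases h : #(a w.2.2.2) < l ε
    · obtain ⟨g, hg⟩ := (hl ε).1.exists_forall_lt (B w ε) ((hB w ε).trans_lt h)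
      exact ⟨g, fun _ => hg⟩
    · exact ⟨(hlne ε).some, fun h' => (h h').elim⟩
  choose g hg using hg
  choose α hα using fun w => hfcof (g w)
  obtain ⟨β, hβ⟩ := hκreg.exists_forall_lt (Set.range α) <| by
    refine mk_range_le.trans_lt ?_
    have h1 : lam < κ := (self_le_add_right _ _).trans_lt hκι
    have h2 : #ι < κ := (self_le_add_left _ _).trans_lt hκι
    simp only [mk_prod, lift_id, mk_ord_toType]
    exact mul_lt_of_lt hκreg.1 hI (mul_lt_of_lt hκreg.1 h1 (mul_lt_of_lt hκreg.1 h1 h2))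
  have hgβ : ∀ w, ∀ᶠ ε in D, g w ε < f β ε := fun w => by
    filter_upwards [hα w, hfinc _ _ (hβ _ ⟨w, rfl⟩)] with ε h h' using h.trans h'
  -- the model
  obtain ⟨i₀, -⟩ := hguess id
  have : Nonempty (Set.range b) := ⟨⟨b i₀, i₀, rfl⟩⟩
  obtain ⟨code⟩ : Nonempty (lam.ord.ToType ≃ lam.ord.ToType × lam.ord.ToType) :=
    Cardinal.eq.1 (by simp [mul_eq_self hlam.1])
  obtain ⟨sb, hsb⟩ : ∃ sb : lam.ord.ToType → Set.range b, Function.Surjective sb := by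
    obtain ⟨k⟩ : Nonempty (Set.range b ↪ lam.ord.ToType) := by
      rw [← Cardinal.le_def]
      simpa using hrange
    exact ⟨Function.invFun k, Function.invFun_surjective k.injective⟩
  have hxb : ∀ B : Set.range b, Nonempty (J ↪ B.1) := by
    rintro ⟨_, i, rfl⟩
    rw [← Cardinal.le_def]
    exact hJ.trans (hb i).ge
  let xb : Set.range b → J → lam.ord.ToType := fun B ε => ((hxb B).some ε).1
  have xb_inj : ∀ B, Function.Injective (xb B) := fun B ε ε' h =>
    (hxb B).some.injective (Subtype.ext h)
  let t : lam.ord.ToType → lam.ord.ToType → lam.ord.ToType := fun τ x =>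
    if h : ∃ ε, xb (sb (code τ).2) ε = x then c (code τ).1 (emb h.choose (f β h.choose)) else x
  have ht : ∀ τ ε, t τ (xb (sb (code τ).2) ε) = c (code τ).1 (emb ε (f β ε)) := fun τ ε => by
    have h : ∃ ε', xb (sb (code τ).2) ε' = xb (sb (code τ).2) ε := ⟨ε, rfl⟩
    simp only [t, dif_pos h]
    rw [xb_inj _ h.choose_spec]
  refine ⟨⟨FeqCarrier t, inferInstance⟩, isFeqModel, mk_eq.trans (by simp), fun j => ⟨fun F => ?_⟩⟩
  change FeqCarrier t ↪[feqLang] N j at F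
  obtain ⟨i, hi⟩ := hguess fun x => e j (F (point x))
  obtain ⟨v₀, hv₀⟩ := hlam.exists_forall_lt (b i) (by
    rw [hb i]
    exact hθμ.trans hμlam')
  obtain ⟨τ₀⟩ := hLne
  choose q hq using fun x v : lam.ord.ToType => exists_value_eq (t := t) τ₀ {x} fun _ => v
  replace hq : ∀ x v, value t τ₀ (q x v) x = v := fun x v =>
    (hq x v).1 x (Finset.mem_singleton_self x)
  have hG : ∀ x n, ∃ v, ∀ τ p, feqE (F (fn τ p)) (F (point x)) ((e j).symm n) →
      value t τ p x = v := fun x n => by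
    by_cases h : ∃ τ p, feqE (F (fn τ p)) (F (point x)) ((e j).symm n)
    · obtain ⟨τ, p, h⟩ := h
      refine ⟨value t τ p x, fun τ' p' h' => ?_⟩
      exact (feqE_map_iff F _ _ _).1 ((hN j).1.trans _ _ _ _ h' ((hN j).1.symm _ _ _ h))
    · exact ⟨x, fun τ p h' => (h ⟨τ, p, h'⟩).elim⟩
  choose G hG using hG
  obtain ⟨φ, hφ⟩ := exists_forall_closed_lt hlam fun x v => e j (F (fn τ₀ (q x v)))
  obtain ⟨ψ, hψ⟩ := exists_forall_closed_lt hlam G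
  obtain ⟨s, hs⟩ := hcE _ (isClub_closurePoints hlam (hμ.trans_lt hμlam')
    fun x => max (max (φ x) (ψ x)) v₀) fun x hx y hy => (hy.not_ge (hx y)).elim
  obtain ⟨v, hv⟩ := hsb ⟨b i, i, rfl⟩
  set τ := code.symm (s, v) with hτ
  have hR : ∀ ε, R j (F (fn τ 0)) s (F (point (xb ⟨b i, i, rfl⟩ ε))) (emb ε (f β ε)) := by
    intro ε ζ'
    set x := xb ⟨b i, i, rfl⟩ ε with hx
    have hval : value t τ 0 x = c s (emb ε (f β ε)) := by
      have := ht τ ε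
      simp only [hτ, code.apply_symm_apply, hv] at this
      exact this
    have hxlt : x < v₀ := hv₀ _ ((hxb ⟨b i, i, rfl⟩).some ε).2
    have hη := hs ζ'
    set η := c s ζ' with hηdef
    have hx' : ∀ y < η, x < η := fun y hy => hxlt.trans ((le_max_right _ _).trans_lt (hη y hy))
    have hη₁ := hφ η fun y hy =>
      ((le_max_left _ _).trans (le_max_left _ _)).trans_lt (hη y hy)
    have hη₂ := hψ η fun y hy =>
      ((le_max_right _ _).trans (le_max_left _ _)).trans_lt (hη y hy)
    rw [← (hc s).lt_iff_lt, ← hval]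
    constructor
    · rintro ⟨m, hm, hE⟩
      rw [hG x (e j m) τ 0 (by simpa using hE)]
      exact hη₂ _ (hx' _ hm) _ hm
    · intro h
      refine ⟨_, hη₁ x (hx' _ h) _ h, (feqE_map_iff F _ _ _).2 ?_⟩
      exact (hq x _).symm
  obtain ⟨ε, hε, hε'⟩ := ((hgβ (j, e j (F (fn τ 0)), s, i)).and (hlim _ (ha i))).exists
  refine hε.not_gt (hg (j, e j (F (fn τ 0)), s, i) ε hε' (f β ε) ?_)
  refine ⟨_, hi ⟨xb ⟨b i, i, rfl⟩ ε, ((hxb ⟨b i, i, rfl⟩).some ε).2, rfl⟩, ?_⟩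
  simpa using hR ε

/-- There is a universal family of models of `T_feq` in every cardinal. -/
theorem exists_isFeqUniversalFamily (lam : Cardinal.{u}) :
    ∃ (I : Type u) (N : I → CategoryTheory.Bundled.{u} feqLang.Structure),
      IsFeqUniversalFamily lam N := by
  let I : Type u := {S : feqLang.Structure lam.ord.ToType //
    ∃ M : CategoryTheory.Bundled.{u} feqLang.Structure, (IsFeqModel M ∧ #M = lam) ∧
      Nonempty (M ≃[feqLang] (⟨lam.ord.ToType, S⟩ :
        CategoryTheory.Bundled.{u} feqLang.Structure))}
  refine ⟨I, fun S => S.2.choose, fun S => S.2.choose_spec.1, fun M hM hcard => ?_⟩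
  obtain ⟨e⟩ := Cardinal.eq.1 (hcard.trans (mk_ord_toType lam).symm)
  let S : feqLang.Structure lam.ord.ToType := e.inducedStructure
  let k : M ≃[feqLang] lam.ord.ToType := e.inducedStructureEquiv
  let s : I := ⟨S, M, ⟨hM, hcard⟩, ⟨k⟩⟩
  obtain ⟨k'⟩ := s.2.choose_spec.2
  exact ⟨s, ⟨(k'.symm.comp k).toEmbedding⟩⟩

theorem ppGamma_le_of_isFeqUniversalFamily {θ μ lam : Cardinal.{u}}
    (hθ : θ.IsRegular) (hθμ : θ < μ) (hlam : lam.IsRegular) (hμlam : Order.succ μ < lam)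
    {ι : Type u} (hpp : lam + #ι < ppGamma θ μ)
    (a b : ι → Set lam.ord.ToType) (ha : ∀ i, #(a i) < μ) (hb : ∀ i, #(b i) = θ)
    (hrange : #(Set.range b) ≤ lam)
    (hguess : ∀ f : lam.ord.ToType → lam.ord.ToType, ∃ i, f '' b i ⊆ a i)
    {I : Type u} (N : I → CategoryTheory.Bundled.{u} feqLang.Structure)
    (hN : IsFeqUniversalFamily lam N) : ppGamma θ μ ≤ #I := by
  by_contra! h
  have hne : (ppSet θ μ).Nonempty := by
    by_contra hemp
    rw [Set.not_nonempty_iff_eq_empty] at hemp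
    simp [ppGamma, hemp] at h
  obtain ⟨κ, hκ, hlt⟩ := exists_lt_of_lt_csSup hne (max_lt hpp h)
  obtain ⟨M, hM, hcard, hemb⟩ := exists_feqModel_not_embedding hθ hθμ hlam hμlam hκ
    ((le_max_left _ _).trans_lt hlt) a b ha hb hrange hguess ((le_max_right _ _).trans_lt hlt) N
    hN.1
  obtain ⟨j, ⟨F⟩⟩ := hN.2 M hM hcard
  exact (hemb j).false F

end Main

theorem mainTheorem3 (θ μ lam : Cardinal.{u})
    (hθ : θ.IsRegular) (hcof : μ.ord.cof = θ) (hθμ : θ < μ)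
    (hlam : lam.IsRegular) (hμlam : Order.succ μ < lam)
    (ι : Type u) (hpp : lam + #ι < ppGamma θ μ)
    (a b : ι → Set lam.ord.ToType)
    (ha : ∀ i, #(a i) < μ) (hb : ∀ i, #(b i) = θ)
    (hrange : #(Set.range b) ≤ lam)
    (hguess : ∀ f : lam.ord.ToType → lam.ord.ToType, ∃ i, f '' b i ⊆ a i) :
    (¬ ∃ N : CategoryTheory.Bundled.{u} feqLang.Structure, IsFeqUniversalModel lam N) ∧
      ppGamma θ μ ≤ feqUniv lam := by
  refine ⟨?_, ?_⟩
  · rintro ⟨N, hN, hcard, huniv⟩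
    have h := ppGamma_le_of_isFeqUniversalFamily hθ hθμ hlam hμlam hpp a b ha hb hrange hguess
      (I := PUnit) (fun _ => N) ⟨fun _ => ⟨hN, hcard⟩, fun M hM hc => ⟨⟨⟩, huniv M hM hc⟩⟩
    rw [mk_punit] at h
    exact ((one_lt_aleph0.trans_le hlam.1).trans_le (self_le_add_right _ _)).not_ge
      (hpp.le.trans h)
  · obtain ⟨I, N, hN⟩ := exists_isFeqUniversalFamily lam
    refine le_csInf ⟨_, I, N, rfl, hN⟩ ?_
    rintro _ ⟨I', N', rfl, hN'⟩
    exact ppGamma_le_of_isFeqUniversalFamily hθ hθμ hlam hμlam hpp a b ha hb hrange hguess N' hN'
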